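/- Let $K$ be a field of characteristic zero and let $H=(u(x,y,z),v(x,y,z),h(x,y))$ be a polynomial map $K^3\to K^3$, where $u,v\in K[x,y,z]$ and $h\in K[x,y]$. Assume that $\deg_z v=1$, $\deg_z u\ge 2$, $H(0)=0$, and that the Jacobian matrix $JH$ is nilpotent. Then there exist $T\in \operatorname{GL}_3(K)$, polynomials $a_1,a_2,c_1,c_2\in K[z]$ and $f\in K[z][t]$ such that $$T^{-1}HT=\bigl(a_2(z)\,f(a_1(z)x+a_2(z)y)+c_1(z),\;-a_1(z)\,f(a_1(z)x+a_2(z)y)+c_2(z),\;0\bigr),$$ where $T^{-1}HT$ denotes the composition of polynomial maps $T^{-1}\circ H\circ T$, with $T$ acting as a linear map on $K^3$, and $f(s)$ denotes the substitution $t=s$ in $f$ (the coefficients of $f$ being polynomials in $z$). -/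

import Mathlib

/-- A polynomial map `K^n → K^n`, given by its `n` components. -/
abbrev PolyMap (n : ℕ) (K : Type*) [Field K] : Type _ :=
  Fin n → MvPolynomial (Fin n) K

namespace PolyMap

variable {n : ℕ} {K : Type*} [Field K]

/-- The Jacobian matrix `(∂ F_i / ∂ x_j)`. -/
noncomputable def jacobian (F : PolyMap n K) :
    Matrix (Fin n) (Fin n) (MvPolynomial (Fin n) K) :=
  Matrix.of fun i j => MvPolynomial.pderiv j (F i)

/-- The composition `F ∘ G`: the polynomials `G_1, …, G_n` are substituted for the
variables in each component of `F`. -/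
noncomputable def comp (F G : PolyMap n K) : PolyMap n K :=
  fun i => MvPolynomial.bind₁ G (F i)

/-- The linear polynomial map `x ↦ A x`. -/
noncomputable def ofMatrix (A : Matrix (Fin n) (Fin n) K) : PolyMap n K :=
  fun i => ∑ j, MvPolynomial.C (A i j) * MvPolynomial.X j

/-- The linear conjugate `T⁻¹ ∘ F ∘ T`. -/
noncomputable def conj (T : GL (Fin n) K) (F : PolyMap n K) : PolyMap n K :=
  comp (ofMatrix (T⁻¹ : GL (Fin n) K).val) (comp F (ofMatrix T.val))

end PolyMap

/-- A polynomial `a ∈ K[z]`, viewed in `K[x, y, z]`; the variables `x, y, z` have the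
indices `0, 1, 2`. -/
noncomputable def polyInZ {K : Type*} [Field K] : Polynomial K →ₐ[K] MvPolynomial (Fin 3) K :=
  Polynomial.aeval (MvPolynomial.X 2)

/-- The value `f(s) ∈ K[x, y, z]` of `f ∈ K[z][t]` at `t = s ∈ K[x, y, z]`. -/
noncomputable def evalOverZ {K : Type*} [Field K] (f : Polynomial (Polynomial K))
    (s : MvPolynomial (Fin 3) K) : MvPolynomial (Fin 3) K :=
  Polynomial.eval₂ (polyInZ (K := K)).toRingHom s f

open MvPolynomial

/-! ### Partial derivatives as univariate derivatives, and degree obstructions in characteristic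
zero. -/

section Derivatives

variable {K : Type*} [Field K]

/-! Nilpotency of `JH` kills its trace, the sum of its principal 2 × 2 minors and its determinant.
The heart is that these three identities force `h` to be constant
(`pderiv_eq_zero_of_nilpotent_jacobian`). Write `v = v₁ z + v₀` and `u = ∑ uₙ zⁿ`, with `d = deg_z
u`, and compare powers of `z`: the coefficients near degree `d`, together with the lowest ones,
leave no room for a nonzero gradient of `h`. The cases split on whether `∂v₁/∂x` vanishes. Since
`H(0) = 0`, then `h = 0`.

What remains is a map `(u, v)` in `x, y`, with `z` as a parameter, whose Jacobian has zero trace and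
determinant. Reducing the gradient of `v` to coprime form gives a relation `a u + b v = c` with `a,
b, c ∈ K[z]` and `a, b` coprime (`exists_coprime_relation`). Bézout's identity then yields `u = b w
+ c₁` and `v = -a w + c₂`; the trace condition makes `w` constant in the direction `(b, -a)`, so `w`
is a polynomial in `a x + b y` over `K[z]` (`exists_eq_evalOverZ`). No change of coordinates is
needed: `T = 1`. -/

theorem derivative_finSuccEquiv {n : ℕ} (p : MvPolynomial (Fin (n + 1)) K) :
    Polynomial.derivative (finSuccEquiv K n p) = finSuccEquiv K n (pderiv 0 p) := by
  induction p using MvPolynomial.induction_on with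
  | C a => simp [finSuccEquiv_apply]
  | add p q hp hq => simp [hp, hq]
  | mul_X p i hp =>
    refine Fin.cases ?_ (fun j => ?_) i
    · simp [hp, finSuccEquiv_X_zero]
      ring
    · simp [hp, finSuccEquiv_X_succ, pderiv_X]
      ring

theorem coeff_finSuccEquiv_pderiv_succ {n : ℕ} (p : MvPolynomial (Fin (n + 1)) K) (j : Fin n)
    (m : ℕ) :
    (finSuccEquiv K n (pderiv j.succ p)).coeff m = pderiv j ((finSuccEquiv K n p).coeff m) := by
  induction p using MvPolynomial.induction_on generalizing m with
  | C a =>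
    have h : finSuccEquiv K n (C a) = Polynomial.C (C a) := by simp [finSuccEquiv_apply]
    rw [h, Polynomial.coeff_C]
    split_ifs <;> simp
  | add p q hp hq => simp [hp, hq]
  | mul_X p i hp =>
    refine Fin.cases ?_ (fun k => ?_) i
    · rcases m with _ | m
      · simp [finSuccEquiv_X_zero, pderiv_X]
      · simp [finSuccEquiv_X_zero, pderiv_X, hp]
    · by_cases hk : k = j
      · subst hk
        simp [finSuccEquiv_X_succ, hp]
      · simp [finSuccEquiv_X_succ, pderiv_X, hp, hk]

/-- A polynomial in `n + 1` variables as a univariate polynomial in the variable `i`. -/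
noncomputable def singleOut {n : ℕ} (i : Fin (n + 1)) :
    MvPolynomial (Fin (n + 1)) K ≃ₐ[K] Polynomial (MvPolynomial (Fin n) K) :=
  (renameEquiv K (Equiv.swap i 0)).trans (finSuccEquiv K n)

theorem derivative_singleOut {n : ℕ} (i : Fin (n + 1)) (p : MvPolynomial (Fin (n + 1)) K) :
    Polynomial.derivative (singleOut i p) = singleOut i (pderiv i p) := by
  have h := pderiv_rename (Equiv.swap i 0).injective i p
  rw [Equiv.swap_apply_left] at h
  simp [singleOut, derivative_finSuccEquiv, h]

theorem natDegree_singleOut {n : ℕ} (i : Fin (n + 1)) (p : MvPolynomial (Fin (n + 1)) K) :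
    (singleOut i p).natDegree = degreeOf i p := by
  have h := degreeOf_rename_of_injective (p := p) (Equiv.swap i 0).injective i
  rw [Equiv.swap_apply_left] at h
  simp [singleOut, natDegree_finSuccEquiv, h]

theorem exists_iterate_pderiv_eq_zero {n : ℕ} (i : Fin (n + 1))
    (f : MvPolynomial (Fin (n + 1)) K) : ∃ m, (pderiv i)^[m] f = 0 := by
  refine ⟨(singleOut i f).natDegree + 1, (singleOut i).injective ?_⟩
  have h : ∀ m, singleOut i ((pderiv i)^[m] f) = Polynomial.derivative^[m] (singleOut i f) := by
    intro m
    induction m with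
    | zero => rfl
    | succ m ih => rw [Function.iterate_succ_apply', Function.iterate_succ_apply', ← ih,
        derivative_singleOut]
  rw [h, map_zero]
  exact Polynomial.iterate_derivative_eq_zero (Nat.lt_succ_self _)

variable [CharZero K]

theorem Polynomial.derivative_eq_zero_of_dvd {R : Type*} [CommRing R] [IsDomain R] [CharZero R]
    {f : Polynomial R} (h : f ∣ derivative f) : derivative f = 0 := by
  by_contra h0
  have h1 := natDegree_le_of_dvd h h0
  have h2 : f.natDegree ≠ 0 := fun h => h0 (derivative_of_natDegree_zero h)
  exact absurd (natDegree_derivative_lt h2) (not_lt.2 h1)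

/-- If `f` had degree `m + 1`, leading coefficients would give `2(m+1)² = (m+1)m`, that is
`(m+1)(m+2) = 0`. -/
theorem Polynomial.derivative_eq_zero_of_two_mul_sq {R : Type*} [CommRing R] [IsDomain R]
    [CharZero R] [IsAddTorsionFree R] {f : Polynomial R}
    (h : 2 * derivative f ^ 2 = f * derivative (derivative f)) : derivative f = 0 := by
  by_contra h0
  have hf : f ≠ 0 := by rintro rfl; simp at h0
  have h2 : f.natDegree ≠ 0 := fun h => h0 (derivative_of_natDegree_zero h)
  have h3 := congrArg leadingCoeff h
  have h4 : (2 : Polynomial R) = C 2 := (map_ofNat C 2).symm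
  rw [h4] at h3
  simp only [leadingCoeff_mul, leadingCoeff_pow, leadingCoeff_derivative, leadingCoeff_C,
    natDegree_derivative] at h3
  obtain ⟨m, hm⟩ := Nat.exists_eq_succ_of_ne_zero h2
  rw [hm] at h3
  have h5 : f.leadingCoeff ≠ 0 := leadingCoeff_ne_zero.2 hf
  have h6 : f.leadingCoeff ^ 2 * ((m + 1) * (m + 2)) = 0 := by
    simp only [Nat.succ_eq_add_one, Nat.add_sub_cancel, Nat.cast_add, Nat.cast_one] at h3
    linear_combination h3
  have h7 : ((m : R) + 1) * (m + 2) ≠ 0 := by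
    have : (((m + 1) * (m + 2) : ℕ) : R) ≠ 0 := by
      rw [Nat.cast_ne_zero]; positivity
    simpa using this
  exact mul_ne_zero (pow_ne_zero 2 h5) h7 h6

/-- The equation is `g'/g = k f'/f`, so `deg g = k deg f ≥ 2 deg f`. This exceeds the degrees of `f
f'` and `f'²`, so `g` divides neither of them unless it is zero. -/
theorem Polynomial.derivative_eq_zero_of_logarithmic {R : Type*} [CommRing R] [IsDomain R]
    [CharZero R] [IsAddTorsionFree R] {f g : Polynomial R} {k : ℕ} (hk : 2 ≤ k) (hg : g ≠ 0)
    (h : derivative g * f = k * g * derivative f)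
    (hd : g ∣ f * derivative f ∨ g ∣ derivative f ^ 2) : derivative f = 0 := by
  by_contra h0
  have hf : f ≠ 0 := by rintro rfl; simp at h0
  have h2 : f.natDegree ≠ 0 := fun h => h0 (derivative_of_natDegree_zero h)
  have h3 := congrArg leadingCoeff h
  have h4 : (k : Polynomial R) = C (k : R) := by simp
  rw [h4] at h3
  simp only [leadingCoeff_mul, leadingCoeff_derivative, leadingCoeff_C] at h3
  have h5 : f.leadingCoeff ≠ 0 := leadingCoeff_ne_zero.2 hf
  have h6 : g.leadingCoeff ≠ 0 := leadingCoeff_ne_zero.2 hg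
  have h7 : (g.natDegree : R) = k * f.natDegree := by
    apply mul_left_cancel₀ (mul_ne_zero h5 h6)
    linear_combination h3
  have h8 : g.natDegree = k * f.natDegree := by exact_mod_cast h7
  have h9 : 2 * f.natDegree ≤ g.natDegree := h8 ▸ Nat.mul_le_mul_right _ hk
  have h10 := natDegree_derivative_lt h2
  rcases hd with hd | hd
  · have := natDegree_le_of_dvd hd (mul_ne_zero hf h0)
    rw [natDegree_mul hf h0] at this
    omega
  · have := natDegree_le_of_dvd hd (pow_ne_zero 2 h0)
    rw [natDegree_pow] at this
    omega

theorem pderiv_eq_zero_of_dvd {n : ℕ} {i : Fin (n + 1)} {f : MvPolynomial (Fin (n + 1)) K}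
    (h : f ∣ pderiv i f) : pderiv i f = 0 := by
  apply (singleOut i).injective
  rw [map_zero, ← derivative_singleOut]
  apply Polynomial.derivative_eq_zero_of_dvd
  rw [derivative_singleOut]
  exact map_dvd _ h

theorem pderiv_eq_zero_of_two_mul_sq {n : ℕ} {i : Fin (n + 1)} {f : MvPolynomial (Fin (n + 1)) K}
    (h : 2 * pderiv i f ^ 2 = f * pderiv i (pderiv i f)) : pderiv i f = 0 := by
  apply (singleOut i).injective
  rw [map_zero, ← derivative_singleOut]
  apply Polynomial.derivative_eq_zero_of_two_mul_sq
  rw [derivative_singleOut, derivative_singleOut, ← map_pow, ← map_mul, ← h, map_mul, map_ofNat]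

theorem pderiv_eq_zero_of_logarithmic {n : ℕ} {i : Fin (n + 1)}
    {f g : MvPolynomial (Fin (n + 1)) K} {k : ℕ} (hk : 2 ≤ k) (hg : g ≠ 0)
    (h : pderiv i g * f = k * g * pderiv i f)
    (hd : g ∣ f * pderiv i f ∨ g ∣ pderiv i f ^ 2) : pderiv i f = 0 := by
  apply (singleOut i).injective
  rw [map_zero, ← derivative_singleOut]
  apply Polynomial.derivative_eq_zero_of_logarithmic (g := singleOut i g) (k := k) hk
  · simpa using hg
  · rw [derivative_singleOut, derivative_singleOut, ← map_mul, h, map_mul, map_mul, map_natCast]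
  · rw [derivative_singleOut, ← map_mul, ← map_pow]
    exact hd.imp (map_dvd _) (map_dvd _)

theorem notMem_vars_of_pderiv_eq_zero {n : ℕ} {i : Fin (n + 1)}
    {f : MvPolynomial (Fin (n + 1)) K} (h : pderiv i f = 0) : i ∉ f.vars := by
  rw [mem_vars_iff_degreeOf_ne_zero, not_not, ← natDegree_singleOut,
    ← Polynomial.derivative_eq_zero, derivative_singleOut, h, map_zero]

theorem pderiv_comm {σ : Type*} {R : Type*} [CommRing R] (i j : σ) (p : MvPolynomial σ R) :
    pderiv i (pderiv j p) = pderiv j (pderiv i p) := by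
  classical
  have h : ⁅(pderiv i : Derivation R (MvPolynomial σ R) (MvPolynomial σ R)),
      (pderiv j : Derivation R (MvPolynomial σ R) (MvPolynomial σ R))⁆ = 0 := by
    apply MvPolynomial.derivation_ext
    intro k
    rw [Derivation.commutator_apply]
    simp only [pderiv_X, Pi.single_apply]
    split_ifs <;> simp
  have h1 := DFunLike.congr_fun h p
  rw [Derivation.commutator_apply, Derivation.zero_apply] at h1
  exact sub_eq_zero.1 h1

end Derivatives

/-! ### The coefficient equations force `h` to be constant. -/

/-- The coefficientwise form, in powers of `z`, of the vanishing of the trace, of the sum of the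
principal `2 × 2` minors and of the determinant of the Jacobian matrix of
`(∑ u n * z ^ n, v₁ * z + v₀, h)`, where `∑ u n * z ^ n` has degree `d ≥ 2` in `z`. -/
structure NilpotencyEquations {K : Type*} [Field K] (u : ℕ → MvPolynomial (Fin 2) K)
    (v₀ v₁ h : MvPolynomial (Fin 2) K) (d : ℕ) : Prop where
  two_le : 2 ≤ d
  lead_ne : u d ≠ 0
  high : ∀ n, d < n → u n = 0
  v₁_ne : v₁ ≠ 0
  trace : ∀ n, pderiv 0 (u (n + 2)) = 0
  trace₁ : pderiv 0 (u 1) = -pderiv 1 v₁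
  trace₀ : pderiv 0 (u 0) = -pderiv 1 v₀
  minor : ∀ n, pderiv 1 (u (n + 3)) * pderiv 0 v₀ + pderiv 1 (u (n + 2)) * pderiv 0 v₁ +
    ((n + 4 : ℕ) : MvPolynomial (Fin 2) K) * u (n + 4) * pderiv 0 h = 0
  minor₂ : pderiv 1 v₁ ^ 2 + pderiv 1 (u 2) * pderiv 0 v₀ + pderiv 1 (u 1) * pderiv 0 v₁ +
    3 * u 3 * pderiv 0 h = 0
  minor₁ : 2 * pderiv 1 v₁ * pderiv 1 v₀ + pderiv 1 (u 1) * pderiv 0 v₀ +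
    pderiv 1 (u 0) * pderiv 0 v₁ + 2 * u 2 * pderiv 0 h = 0
  minor₀ : pderiv 1 v₀ ^ 2 + pderiv 1 (u 0) * pderiv 0 v₀ + u 1 * pderiv 0 h +
    v₁ * pderiv 1 h = 0
  det : ∀ n, pderiv 0 h * (pderiv 1 (u (n + 2)) * v₁ -
      ((n + 3 : ℕ) : MvPolynomial (Fin 2) K) * u (n + 3) * pderiv 1 v₀ -
      ((n + 2 : ℕ) : MvPolynomial (Fin 2) K) * u (n + 2) * pderiv 1 v₁) +
    pderiv 1 h * (((n + 3 : ℕ) : MvPolynomial (Fin 2) K) * u (n + 3) * pderiv 0 v₀ +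
      ((n + 2 : ℕ) : MvPolynomial (Fin 2) K) * u (n + 2) * pderiv 0 v₁) = 0
  det₁ : pderiv 0 h * (pderiv 1 (u 1) * v₁ - 2 * u 2 * pderiv 1 v₀ - u 1 * pderiv 1 v₁) +
    pderiv 1 h * (2 * u 2 * pderiv 0 v₀ + u 1 * pderiv 0 v₁ + pderiv 1 v₁ * v₁) = 0
  det₀ : pderiv 0 h * (pderiv 1 (u 0) * v₁ - u 1 * pderiv 1 v₀) +
    pderiv 1 h * (u 1 * pderiv 0 v₀ + pderiv 1 v₀ * v₁) = 0

namespace NilpotencyEquations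

variable {K : Type*} [Field K] [CharZero K] {u : ℕ → MvPolynomial (Fin 2) K}
  {v₀ v₁ h : MvPolynomial (Fin 2) K} {d : ℕ}

theorem natCast_lead_ne (H : NilpotencyEquations u v₀ v₁ h d) :
    ((d : ℕ) : MvPolynomial (Fin 2) K) * u d ≠ 0 :=
  mul_ne_zero (Nat.cast_ne_zero.2 (by have := H.two_le; omega)) H.lead_ne

/-- If `∂h/∂x ≠ 0`, the top coefficients of the determinant make the gradients of `v₁` and `v₀`
parallel to that of `h` (`e2`, `e3`). The rest of the determinant then does the same for `u 1` and
`u 0` (`e5`, `e6`, read through the trace) and kills `∂(u n)/∂y` for `n ≥ 2`. In degree `d - 1` the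
minor equation, multiplied by `∂h/∂x` if `d ≤ 3`, retains only the term in `d * u d * ∂h/∂x`, which
is nonzero. -/
theorem of_pderiv_v₁_ne (H : NilpotencyEquations u v₀ v₁ h d) (hv : pderiv 0 v₁ ≠ 0) :
    pderiv 0 h = 0 ∧ pderiv 1 h = 0 := by
  obtain ⟨k, rfl⟩ := Nat.exists_eq_add_of_le' H.two_le
  have hc := H.natCast_lead_ne
  have hk3 : u (k + 3) = 0 := H.high _ (by omega)
  have hk4 : u (k + 4) = 0 := H.high _ (by omega)
  have e1 : pderiv 1 (u (k + 2)) = 0 := by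
    have := H.minor k
    rw [hk3, hk4] at this
    simpa [hv] using this
  have e2 : pderiv 1 h * pderiv 0 v₁ = pderiv 0 h * pderiv 1 v₁ := by
    have := H.det k
    rw [hk3, e1] at this
    apply mul_left_cancel₀ hc
    linear_combination this
  by_cases hx : pderiv 0 h = 0
  · refine ⟨hx, ?_⟩
    rw [hx, zero_mul] at e2
    exact (mul_eq_zero.1 e2).resolve_right hv
  exfalso
  have e3 : pderiv 0 h * pderiv 1 v₀ = pderiv 1 h * pderiv 0 v₀ := by
    apply mul_left_cancel₀ hc
    rcases k with _ | k
    · have h1 := H.minor₂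
      have h2 := H.det₁
      rw [hk3, e1] at h1
      apply mul_right_cancel₀ hv
      push_cast
      linear_combination v₁ * pderiv 0 h * h1 - pderiv 0 v₁ * h2 +
        (v₁ * pderiv 1 v₁ + u 1 * pderiv 0 v₁) * e2
    · have h1 : pderiv 1 (u (k + 2)) = 0 := by
        have := H.minor k
        change u (k + 4) = 0 at hk3
        change pderiv 1 (u (k + 3)) = 0 at e1
        rw [hk3, e1] at this
        simpa [hv] using this
      have h2 := H.det k
      rw [h1] at h2
      push_cast at h2 ⊢
      linear_combination (k + 2) * u (k + 2) * e2 - h2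
  have e4 : ∀ n, pderiv 1 (u (n + 2)) = 0 := by
    intro n
    have := H.det n
    apply mul_left_cancel₀ (mul_ne_zero hx H.v₁_ne)
    push_cast at this ⊢
    linear_combination this + (n + 3) * u (n + 3) * e3 - (n + 2) * u (n + 2) * e2
  have e5 : pderiv 0 h * pderiv 1 (u 1) + pderiv 1 h * pderiv 1 v₁ = 0 := by
    apply mul_left_cancel₀ H.v₁_ne
    linear_combination H.det₁ + 2 * u 2 * e3 - u 1 * e2
  have e6 : pderiv 0 h * pderiv 1 (u 0) + pderiv 1 h * pderiv 1 v₀ = 0 := by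
    apply mul_left_cancel₀ H.v₁_ne
    linear_combination H.det₀ + u 1 * e3
  apply mul_ne_zero hc hx
  rcases k with _ | _ | k
  · apply mul_left_cancel₀ hx
    push_cast
    linear_combination pderiv 0 h * H.minor₁ - pderiv 0 v₀ * e5 - pderiv 0 v₁ * e6 -
      pderiv 1 v₁ * e3 + pderiv 1 v₀ * e2
  · apply mul_left_cancel₀ hx
    push_cast
    have h1 := e4 0
    linear_combination pderiv 0 h * H.minor₂ - pderiv 0 v₁ * e5 + pderiv 1 v₁ * e2 -
      pderiv 0 h * pderiv 0 v₀ * h1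
  · have := H.minor k
    rw [e4 k, e4 (k + 1)] at this
    linear_combination this

/-- With `p = ∂(u (d-1))/∂y` and `c = d * u d`, the coefficients of degree `d - 1` express `c ∂h/∂x`
and `c² ∂h/∂y` through `p`, `c`, `v₁` and the derivatives of `v₀`. Substitution in the constant
coefficients collapses to `(p v₁)² = 0`, while `p ∂v₀/∂x = -c ∂h/∂x ≠ 0`. -/
theorem pderiv_lead_ne (H : NilpotencyEquations u v₀ v₁ h d) (hv : pderiv 0 v₁ = 0)
    (hv' : pderiv 1 v₁ = 0) (hx : pderiv 0 h ≠ 0) : pderiv 1 (u d) ≠ 0 := by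
  intro hu
  obtain ⟨k, rfl⟩ := Nat.exists_eq_add_of_le' H.two_le
  have hc := H.natCast_lead_ne
  set c : MvPolynomial (Fin 2) K := ((k + 2 : ℕ) : MvPolynomial (Fin 2) K) * u (k + 2) with hcd
  have e1 : pderiv 1 (u (k + 1)) * pderiv 0 v₀ + c * pderiv 0 h = 0 := by
    rcases k with _ | _ | k
    · have := H.minor₁
      rw [hv, hv'] at this
      rw [hcd]
      push_cast
      linear_combination this
    · have := H.minor₂
      rw [hv, hv'] at this
      rw [hcd]
      push_cast
      norm_num at this ⊢
      linear_combination this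
    · have := H.minor k
      rw [hv] at this
      rw [hcd]
      linear_combination this
  have e2 : pderiv 0 h * (pderiv 1 (u (k + 1)) * v₁ - c * pderiv 1 v₀) +
      pderiv 1 h * (c * pderiv 0 v₀) = 0 := by
    rcases k with _ | k
    · have := H.det₁
      rw [hv, hv'] at this
      rw [hcd]
      push_cast
      linear_combination this
    · have := H.det k
      rw [hv, hv'] at this
      rw [hcd]
      linear_combination this
  clear_value c
  generalize pderiv 1 (u (k + 1)) = p at e1 e2
  have hp : p * pderiv 0 v₀ ≠ 0 := by
    intro h0
    rw [h0, zero_add] at e1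
    exact mul_ne_zero hc hx e1
  have hp1 := left_ne_zero_of_mul hp
  have hp2 := right_ne_zero_of_mul hp
  have e3 : c ^ 2 * pderiv 1 h = p * (p * v₁ - c * pderiv 1 v₀) := by
    apply mul_left_cancel₀ hp2
    linear_combination c * e2 - (p * v₁ - c * pderiv 1 v₀) * e1
  have e4 : -c * pderiv 0 v₀ * pderiv 1 (u 0) + p * u 1 * pderiv 0 v₀ + p * v₁ * pderiv 1 v₀ -
      c * pderiv 1 v₀ ^ 2 = 0 := by
    apply mul_left_cancel₀ (mul_ne_zero hp1 H.v₁_ne)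
    linear_combination c ^ 2 * H.det₀ - c * (pderiv 1 (u 0) * v₁ - u 1 * pderiv 1 v₀) * e1 -
      (u 1 * pderiv 0 v₀ + pderiv 1 v₀ * v₁) * e3
  have e5 : (p * v₁) ^ 2 = 0 := by
    linear_combination c ^ 2 * H.minor₀ + c * e4 - c * u 1 * e1 - v₁ * e3
  exact mul_ne_zero hp1 H.v₁_ne (pow_eq_zero_iff two_ne_zero |>.1 e5)

/-- Once `∂v₀/∂x ≠ 0` is known, `d ≥ 3` contradicts the determinant in degree `d - 1`. For `d = 2`,
differentiating the determinant equations yields `2 (∂v₁/∂y)² = v₁ ∂²v₁/∂y²`, so `∂v₁/∂y = 0` by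
degree in `y`. -/
theorem pderiv_one_eq_zero (H : NilpotencyEquations u v₀ v₁ h d) (hv : pderiv 0 v₁ = 0)
    (hx : pderiv 0 h = 0) : pderiv 1 h = 0 := by
  by_contra hy
  have hw : pderiv 0 v₀ ≠ 0 := by
    intro hw
    have h1 := H.det₁
    have h0 := H.det₀
    have h2 := H.minor₀
    simp only [hv, hx, hw, mul_zero, zero_mul, zero_add, mul_eq_zero, hy, false_or, H.v₁_ne,
      or_false] at h1 h0
    simp [h0, hw, hx, hy, H.v₁_ne] at h2
  obtain ⟨k, rfl⟩ := Nat.exists_eq_add_of_le' H.two_le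
  rcases k with _ | k
  · have h1 : 2 * u 2 * pderiv 0 v₀ + pderiv 1 v₁ * v₁ = 0 := by
      have := H.det₁
      rw [hx, hv] at this
      apply mul_left_cancel₀ hy
      linear_combination this
    have h0 : u 1 * pderiv 0 v₀ + pderiv 1 v₀ * v₁ = 0 := by
      have := H.det₀
      rw [hx] at this
      apply mul_left_cancel₀ hy
      linear_combination this
    have h2 : pderiv 1 v₁ ^ 2 + pderiv 1 (u 2) * pderiv 0 v₀ = 0 := by
      have := H.minor₂
      rw [hx, hv] at this
      linear_combination this
    have hu2 : 2 * u 2 ≠ 0 := mul_ne_zero two_ne_zero H.lead_ne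
    have t2 := H.trace 0
    norm_num at t2
    have hw0 : pderiv 0 (pderiv 0 v₀) = 0 := by
      have := congrArg (pderiv 0) h1
      have c2 : pderiv 0 (2 : MvPolynomial (Fin 2) K) = 0 := by
        simpa using (pderiv 0 : Derivation K (MvPolynomial (Fin 2) K) _).map_natCast 2
      simp only [map_add, pderiv_mul, t2, hv, pderiv_comm 0 1 v₁, map_zero, c2] at this
      apply mul_left_cancel₀ hu2
      linear_combination this
    have h3 : pderiv 1 (pderiv 0 v₀) * v₁ = pderiv 1 v₁ * pderiv 0 v₀ := by
      have := congrArg (pderiv 0) h0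
      simp only [map_add, pderiv_mul, H.trace₁, hw0, hv, pderiv_comm 0 1 v₀, map_zero] at this
      linear_combination this
    have h4 : 2 * pderiv 1 (u 2) * pderiv 0 v₀ + 2 * u 2 * pderiv 1 (pderiv 0 v₀) +
        pderiv 1 (pderiv 1 v₁) * v₁ + pderiv 1 v₁ ^ 2 = 0 := by
      have := congrArg (pderiv 1) h1
      have c2 : pderiv 1 (2 : MvPolynomial (Fin 2) K) = 0 := by
        simpa using (pderiv 1 : Derivation K (MvPolynomial (Fin 2) K) _).map_natCast 2
      simp only [map_add, pderiv_mul, map_zero, c2] at this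
      linear_combination this
    have h5 : pderiv 1 v₁ = 0 := by
      apply pderiv_eq_zero_of_two_mul_sq
      apply mul_left_cancel₀ hw
      linear_combination -pderiv 0 v₀ * h4 + 2 * pderiv 0 v₀ * h2 +
        pderiv 1 (pderiv 0 v₀) * h1 - pderiv 1 v₁ * h3
    rw [h5, zero_mul, add_zero] at h1
    exact mul_ne_zero hu2 hw h1
  · have := H.det k
    rw [hx, hv] at this
    apply mul_ne_zero hy (mul_ne_zero H.natCast_lead_ne hw)
    linear_combination this

/-- The top determinant coefficient (`e1`) says that `u d` behaves like `v₁ ^ d` in the variable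
`y`. For `d = 2` and `d = 3` the minor equation makes `u d` divide `v₁ ∂v₁/∂y`, respectively
`(∂v₁/∂y)²`, which is impossible by degree unless `∂v₁/∂y = 0`. -/
theorem of_pderiv_v₁_eq (H : NilpotencyEquations u v₀ v₁ h d) (hv : pderiv 0 v₁ = 0) :
    pderiv 0 h = 0 := by
  by_contra hx
  have hc := H.natCast_lead_ne
  have hld := H.pderiv_lead_ne hv
  obtain ⟨k, rfl⟩ := Nat.exists_eq_add_of_le' H.two_le
  have hk3 : u (k + 3) = 0 := H.high _ (by omega)
  have e1 : pderiv 1 (u (k + 2)) * v₁ =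
      ((k + 2 : ℕ) : MvPolynomial (Fin 2) K) * u (k + 2) * pderiv 1 v₁ := by
    have := H.det k
    rw [hk3, hv] at this
    apply mul_left_cancel₀ hx
    linear_combination this
  by_cases hy : pderiv 1 v₁ = 0
  · refine hld hy hx ?_
    rw [hy, mul_zero] at e1
    exact (mul_eq_zero.1 e1).resolve_right H.v₁_ne
  rcases k with _ | k
  · apply hy
    refine pderiv_eq_zero_of_logarithmic le_rfl H.lead_ne e1 (Or.inl ⟨-2 * pderiv 0 v₀, ?_⟩)
    have := H.minor₂
    rw [hk3, hv] at this
    apply mul_left_cancel₀ hy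
    push_cast at e1
    norm_num at e1 this ⊢
    linear_combination v₁ * this - pderiv 0 v₀ * e1
  · have hu : pderiv 1 (u (k + 1 + 2)) ≠ 0 := by
      intro h0
      rw [h0, zero_mul] at e1
      exact mul_ne_zero hc hy e1.symm
    have hw : pderiv 0 v₀ = 0 := by
      have := H.minor k
      change u (k + 4) = 0 at hk3
      rw [hk3, hv] at this
      apply mul_left_cancel₀ hu
      linear_combination this
    rcases k with _ | k
    · apply hy
      refine pderiv_eq_zero_of_logarithmic (by norm_num) H.lead_ne e1
        (Or.inr ⟨-3 * pderiv 0 h, ?_⟩)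
      have := H.minor₂
      rw [hw, hv] at this
      norm_num at this ⊢
      linear_combination this
    · have := H.minor k
      rw [hw, hv] at this
      apply mul_ne_zero hc hx
      linear_combination this

theorem pderiv_eq_zero (H : NilpotencyEquations u v₀ v₁ h d) :
    pderiv 0 h = 0 ∧ pderiv 1 h = 0 := by
  by_cases hv : pderiv 0 v₁ = 0
  · have hx := H.of_pderiv_v₁_eq hv
    exact ⟨hx, H.pderiv_one_eq_zero hv hx⟩
  · exact H.of_pderiv_v₁_ne hv

end NilpotencyEquations

/-! ### Reading off coefficients of powers of `z`. -/

section LastVariable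

variable {K : Type*} [Field K]

/-- `K[x, y, z]` as the polynomial ring in `z` over `K[x, y]`. -/
noncomputable def polynomialInZ :
    MvPolynomial (Fin 3) K ≃ₐ[K] Polynomial (MvPolynomial (Fin 2) K) :=
  (renameEquiv K (finRotate 3)).trans (finSuccEquiv K 2)

theorem polynomialInZ_apply (p : MvPolynomial (Fin 3) K) :
    polynomialInZ p = finSuccEquiv K 2 (rename (finRotate 3) p) := rfl

theorem polynomialInZ_pderiv_two (p : MvPolynomial (Fin 3) K) :
    polynomialInZ (pderiv 2 p) = Polynomial.derivative (polynomialInZ p) := by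
  have h := pderiv_rename (finRotate 3).injective 2 p
  rw [show finRotate 3 2 = 0 by decide] at h
  rw [polynomialInZ_apply, polynomialInZ_apply, derivative_finSuccEquiv, h]

/-- The rotation takes `castSucc` to `succ`, so `x` and `y` keep the indices `0` and `1`; the swap
in `singleOut` would exchange them. -/
theorem coeff_polynomialInZ_pderiv (j : Fin 2) (p : MvPolynomial (Fin 3) K) (m : ℕ) :
    (polynomialInZ (pderiv j.castSucc p)).coeff m = pderiv j ((polynomialInZ p).coeff m) := by
  have h := pderiv_rename (finRotate 3).injective j.castSucc p
  rw [show finRotate 3 j.castSucc = j.succ by clear h; revert j; decide] at h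
  rw [polynomialInZ_apply, polynomialInZ_apply, ← coeff_finSuccEquiv_pderiv_succ, h]

theorem polynomialInZ_rename_castSucc (p : MvPolynomial (Fin 2) K) :
    polynomialInZ (rename Fin.castSucc p) = Polynomial.C p := by
  rw [polynomialInZ_apply, rename_rename,
    show finRotate 3 ∘ Fin.castSucc = (Fin.succ : Fin 2 → Fin 3) by decide]
  induction p using MvPolynomial.induction_on with
  | C a => simp [finSuccEquiv_apply]
  | add p q hp hq => rw [map_add, map_add, hp, hq, Polynomial.C_add]
  | mul_X p i hp => rw [map_mul, map_mul, hp, rename_X, finSuccEquiv_X_succ, Polynomial.C_mul]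

theorem natDegree_polynomialInZ (p : MvPolynomial (Fin 3) K) :
    (polynomialInZ p).natDegree = degreeOf 2 p := by
  have h := degreeOf_rename_of_injective (p := p) (finRotate 3).injective 2
  rw [show finRotate 3 2 = 0 by decide] at h
  rw [polynomialInZ_apply, natDegree_finSuccEquiv, h]

theorem Polynomial.coeff_succ_mul_linear {R : Type*} [CommRing R] (p : Polynomial R) (a b : R)
    (n : ℕ) : (p * (C a * X + C b)).coeff (n + 1) = p.coeff n * a + p.coeff (n + 1) * b := by
  rw [mul_add, ← mul_assoc, coeff_add, coeff_mul_X, coeff_mul_C, coeff_mul_C]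

theorem Polynomial.coeff_zero_mul_linear {R : Type*} [CommRing R] (p : Polynomial R) (a b : R) :
    (p * (C a * X + C b)).coeff 0 = p.coeff 0 * b := by
  rw [mul_add, ← mul_assoc, coeff_add, coeff_mul_X_zero, coeff_mul_C, zero_add]

variable [CharZero K]

theorem pderiv_eq_zero_of_nilpotent_jacobian {u v : MvPolynomial (Fin 3) K}
    {h : MvPolynomial (Fin 2) K} (hv : degreeOf 2 v = 1) (hu : 2 ≤ degreeOf 2 u)
    (trace : pderiv 0 u + pderiv 1 v = 0)
    (minor : pderiv 0 u * pderiv 1 v - pderiv 1 u * pderiv 0 v -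
      pderiv 2 u * rename Fin.castSucc (pderiv 0 h) -
      pderiv 2 v * rename Fin.castSucc (pderiv 1 h) = 0)
    (det : rename Fin.castSucc (pderiv 0 h) *
        (pderiv 1 u * pderiv 2 v - pderiv 2 u * pderiv 1 v) +
      rename Fin.castSucc (pderiv 1 h) *
        (pderiv 2 u * pderiv 0 v - pderiv 0 u * pderiv 2 v) = 0) :
    pderiv 0 h = 0 ∧ pderiv 1 h = 0 := by
  have hux : pderiv 0 u = -pderiv 1 v := eq_neg_of_add_eq_zero_left trace
  rw [← natDegree_polynomialInZ] at hv hu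
  have hV := Polynomial.eq_X_add_C_of_natDegree_le_one hv.le
  have hhigh : ∀ n, (polynomialInZ v).coeff (n + 2) = 0 := fun n =>
    Polynomial.coeff_eq_zero_of_natDegree_lt (by omega)
  have hlin : ∀ j : Fin 2, polynomialInZ (pderiv j.castSucc v) =
      Polynomial.C (pderiv j ((polynomialInZ v).coeff 1)) * Polynomial.X +
        Polynomial.C (pderiv j ((polynomialInZ v).coeff 0)) := by
    intro j
    ext1 m
    rw [coeff_polynomialInZ_pderiv]
    rcases m with _ | _ | m
    · simp
    · simp
    · rw [hhigh]
      simp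
  have hVx := hlin 0
  have hVy := hlin 1
  have hVz : polynomialInZ (pderiv 2 v) = Polynomial.C ((polynomialInZ v).coeff 1) := by
    rw [polynomialInZ_pderiv_two, hV]
    simp
  have hUx : ∀ n, pderiv 0 ((polynomialInZ u).coeff n) =
      -pderiv 1 ((polynomialInZ v).coeff n) := by
    intro n
    rw [← coeff_polynomialInZ_pderiv, ← coeff_polynomialInZ_pderiv, ← Polynomial.coeff_neg,
      ← map_neg]
    exact congrArg (fun p => (polynomialInZ p).coeff n) hux
  have hUy : ∀ n, (polynomialInZ (pderiv 1 u)).coeff n = pderiv 1 ((polynomialInZ u).coeff n) :=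
    coeff_polynomialInZ_pderiv 1 u
  have hUz : ∀ n, (polynomialInZ (pderiv 2 u)).coeff n =
      (polynomialInZ u).coeff (n + 1) * (n + 1) := fun n => by
    rw [polynomialInZ_pderiv_two, Polynomial.coeff_derivative]
  -- After this substitution every product has a factor of degree at most one in `z`, so its
  -- coefficients are sums of at most two terms.
  rw [hux] at minor det
  have M := congrArg polynomialInZ minor
  have D := congrArg polynomialInZ det
  simp only [map_add, map_sub, map_mul, map_neg, map_zero, polynomialInZ_rename_castSucc,
    hVz] at M D
  simp only [Fin.castSucc_zero, Fin.castSucc_one] at hVx hVy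
  rw [hVx, hVy] at M D
  have hne : (polynomialInZ v).coeff 1 ≠ 0 := by
    rw [← hv]
    exact Polynomial.leadingCoeff_ne_zero.2 (by rintro h0; simp [h0] at hv)
  generalize hv0 : (polynomialInZ v).coeff 0 = v₀ at *
  generalize hv1 : (polynomialInZ v).coeff 1 = v₁ at *
  have Mc := fun n => congrArg (fun p => Polynomial.coeff p n) M
  have Dc := fun n => congrArg (fun p => Polynomial.coeff p n) D
  simp only [neg_mul, Polynomial.coeff_add, Polynomial.coeff_sub, Polynomial.coeff_neg,
    Polynomial.coeff_C_mul, Polynomial.coeff_mul_C, Polynomial.coeff_zero, sub_neg_eq_add] at Mc Dc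
  refine NilpotencyEquations.pderiv_eq_zero (u := (polynomialInZ u).coeff) (v₀ := v₀) (v₁ := v₁)
    (d := (polynomialInZ u).natDegree) ⟨hu, ?_, ?_, hne, ?_, ?_, ?_, ?_, ?_, ?_, ?_, ?_, ?_, ?_⟩
  · exact Polynomial.leadingCoeff_ne_zero.2 (by rintro h0; simp [h0] at hu)
  · exact fun n hn => Polynomial.coeff_eq_zero_of_natDegree_lt hn
  · intro n
    rw [hUx, hhigh, map_zero, neg_zero]
  · rw [hUx, hv1]
  · rw [hUx, hv0]
  · intro n
    have := Mc (n + 3)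
    simp only [Polynomial.coeff_succ_mul_linear, hUy, hUz, Polynomial.coeff_C_succ] at this
    simp at this
    push_cast
    linear_combination -this
  · have := Mc 2
    simp only [Polynomial.coeff_succ_mul_linear, hUy, hUz] at this
    simp at this
    linear_combination -this
  · have := Mc 1
    simp only [Polynomial.coeff_succ_mul_linear, hUy, hUz] at this
    simp [Polynomial.coeff_X, Polynomial.coeff_C] at this
    linear_combination -this
  · have := Mc 0
    simp only [Polynomial.coeff_zero_mul_linear, hUy, hUz] at this
    simp [Polynomial.coeff_X, Polynomial.coeff_C] at this
    linear_combination -this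
  · intro n
    have := Dc (n + 2)
    simp only [Polynomial.coeff_succ_mul_linear, hUy, hUz] at this
    simp [Polynomial.coeff_X] at this
    push_cast
    linear_combination this
  · have := Dc 1
    simp only [Polynomial.coeff_succ_mul_linear, hUy, hUz] at this
    simp [Polynomial.coeff_X] at this
    linear_combination this
  · have := Dc 0
    simp only [Polynomial.coeff_zero_mul_linear, hUy, hUz] at this
    simp [Polynomial.coeff_X, Polynomial.coeff_C] at this
    linear_combination this

end LastVariable

/-! ### Maps in `x, y` over `K[z]` with nilpotent Jacobian. -/

section Burgers

variable {K : Type*} [Field K]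

theorem derivation_aeval {σ A M : Type*} [Fintype σ] [CommRing A] [Algebra K A] [AddCommGroup M]
    [Module A M] [Module K M] (D : Derivation K A M) (g : σ → A) (p : MvPolynomial σ K) :
    D (aeval g p) = ∑ i, aeval g (pderiv i p) • D (g i) := by
  classical
  induction p using MvPolynomial.induction_on with
  | C a => simp
  | add p q hp hq => simp [hp, hq, add_smul, Finset.sum_add_distrib]
  | mul_X p i hp =>
    simp [hp, add_smul, Finset.sum_add_distrib, pderiv_X, Pi.single_apply, Finset.smul_sum,
      smul_smul, apply_ite (aeval g), ite_smul]

theorem pderiv_polyInZ {j : Fin 3} (hj : j ≠ 2) (a : Polynomial K) :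
    pderiv j (polyInZ a) = 0 := by
  rw [polyInZ, Derivation.map_aeval, pderiv_X_of_ne hj.symm, smul_zero]

theorem aeval_polyInZ {A : Type*} [CommRing A] [Algebra K A] (g : Fin 3 → A) (a : Polynomial K) :
    aeval g (polyInZ a) = Polynomial.aeval (g 2) a := by
  rw [polyInZ, ← Polynomial.aeval_algHom_apply, aeval_X]

theorem polyInZ_C (r : K) : polyInZ (Polynomial.C r) = C r := Polynomial.aeval_C _ r

theorem isCoprime_of_isRelPrime_polyInZ {a b : Polynomial K}
    (h : IsRelPrime (polyInZ a) (polyInZ b)) : IsCoprime a b := by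
  apply IsRelPrime.isCoprime
  intro d hda hdb
  have h1 : IsUnit (polyInZ d) := h (map_dvd _ hda) (map_dvd _ hdb)
  -- Setting `x = y = 0` is a left inverse of `polyInZ`.
  have h2 := h1.map (aeval (R := K) (![0, 0, Polynomial.X] : Fin 3 → Polynomial K))
  rw [aeval_polyInZ] at h2
  simpa using h2

theorem iterate_pderiv_comm {σ : Type*} (i j : σ) (m : ℕ) (p : MvPolynomial σ K) :
    (pderiv i)^[m] (pderiv j p) = pderiv j ((pderiv i)^[m] p) :=
  (Function.Commute.iterate_left (f := pderiv i) (g := pderiv j) (fun q => pderiv_comm i j q) m) p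

theorem evalOverZ_aeval (g : Fin 3 → Polynomial (Polynomial K)) (s w : MvPolynomial (Fin 3) K) :
    evalOverZ (aeval g w) s = aeval (fun i => evalOverZ (g i) s) w := by
  have h : (Polynomial.eval₂RingHom (polyInZ (K := K)).toRingHom s).comp
      (aeval (R := K) g).toRingHom = (aeval fun i => evalOverZ (g i) s).toRingHom := by
    apply MvPolynomial.ringHom_ext
    · intro r
      simp [Polynomial.algebraMap_apply, polyInZ_C]
    · intro i
      simp [evalOverZ]
  exact DFunLike.congr_fun h w

variable [CharZero K]

theorem exists_eq_polyInZ {p : MvPolynomial (Fin 3) K} (h0 : pderiv 0 p = 0)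
    (h1 : pderiv 1 p = 0) : ∃ a, p = polyInZ a := by
  refine ⟨aeval ![0, 0, Polynomial.X] p, ?_⟩
  rw [← AlgHom.comp_apply]
  have := hom_congr_vars (f₁ := RingHom.id (MvPolynomial (Fin 3) K))
    (f₂ := ((polyInZ (K := K)).comp (aeval ![0, 0, Polynomial.X])).toRingHom)
    (p₁ := p) (p₂ := p) (by ext1 x; simp [polyInZ_C]) ?_ rfl
  · exact this
  · intro i hi _
    fin_cases i
    · exact absurd hi (notMem_vars_of_pderiv_eq_zero h0)
    · exact absurd hi (notMem_vars_of_pderiv_eq_zero h1)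
    · simp [polyInZ]

/-- A rotated Euler field `B ∂ᵢ - A ∂ⱼ` has no polynomial eigenvectors for the eigenvalues `k α`
with `k > 0`. -/
theorem eq_zero_of_euler_eigenvector {n : ℕ} {i j : Fin (n + 1)}
    {A B α : MvPolynomial (Fin (n + 1)) K} (hα : α ≠ 0)
    (hAi : pderiv i A = 0) (hAj : pderiv j A = α) (hBi : pderiv i B = -α) (hBj : pderiv j B = 0)
    {w : MvPolynomial (Fin (n + 1)) K} {k : ℕ} (hk : k ≠ 0)
    (hw : B * pderiv i w - A * pderiv j w = k * α * w) : w = 0 := by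
  have hαi : pderiv i α = 0 := by rw [← hAj, pderiv_comm, hAi, map_zero]
  have hαj : pderiv j α = 0 := by
    rw [← neg_eq_zero, ← map_neg, ← hBi, pderiv_comm, hBj, map_zero]
  obtain ⟨a, ha⟩ := exists_iterate_pderiv_eq_zero i w
  obtain ⟨b, hb⟩ := exists_iterate_pderiv_eq_zero j w
  induction hm : a + b generalizing a b w k with
  | zero =>
    obtain rfl : a = 0 := by omega
    exact ha
  | succ m ih =>
    rcases a with _ | a
    · exact ha
    rcases b with _ | b
    · exact hb
    have hki : pderiv i (k : MvPolynomial (Fin (n + 1)) K) = 0 := Derivation.map_natCast _ k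
    have hkj : pderiv j (k : MvPolynomial (Fin (n + 1)) K) = 0 := Derivation.map_natCast _ k
    -- Either derivative of an eigenvector is an eigenvector for `(k + 1) α` and has a smaller order
    -- of nilpotency, so induction kills it.
    have hwi : pderiv i w = 0 := by
      refine ih (k := k + 1) (Nat.succ_ne_zero _) ?_ a ha (b + 1) ?_ (by omega)
      · have := congrArg (pderiv i) hw
        simp only [map_sub, pderiv_mul, hBi, hAi, hαi, hki, pderiv_comm i j w] at this
        push_cast
        linear_combination this
      · rw [iterate_pderiv_comm, hb, map_zero]
    have hwj : pderiv j w = 0 := by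
      refine ih (k := k + 1) (Nat.succ_ne_zero _) ?_ (a + 1) ?_ b hb (by omega)
      · have := congrArg (pderiv j) hw
        simp only [map_sub, pderiv_mul, hBj, hAj, hαj, hkj, pderiv_comm j i w] at this
        push_cast
        linear_combination this
      · rw [iterate_pderiv_comm, ha, map_zero]
    rw [hwi, hwj, mul_zero, mul_zero, sub_zero] at hw
    exact (mul_eq_zero.1 hw.symm).resolve_left (mul_ne_zero (Nat.cast_ne_zero.2 hk) hα)

/-- If the Jacobian matrix of `(u, v)` with respect to `x, y` is nilpotent, then `u` and `v` satisfy
a linear relation with coprime coefficients in `K[z]`. -/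
theorem exists_coprime_relation {u v : MvPolynomial (Fin 3) K}
    (trace : pderiv 0 u + pderiv 1 v = 0)
    (det : pderiv 0 u * pderiv 1 v - pderiv 1 u * pderiv 0 v = 0) :
    ∃ a b c : Polynomial K, IsCoprime a b ∧ polyInZ a * u + polyInZ b * v = polyInZ c := by
  have hux : pderiv 0 u = -pderiv 1 v := eq_neg_of_add_eq_zero_left trace
  by_cases hv : pderiv 0 v = 0
  · have hvy : pderiv 1 v = 0 := by
      rw [hux, hv] at det
      rw [← pow_eq_zero_iff (two_ne_zero)]
      linear_combination -det
    obtain ⟨c, hc⟩ := exists_eq_polyInZ hv hvy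
    exact ⟨0, 1, c, isCoprime_zero_left.2 isUnit_one, by simp [← hc]⟩
  -- The gradient of `v` is `g (A, B)` with `A, B` coprime. The determinant gives `g = A k`, so the
  -- gradient of `u` is `-B k (A, B)`. Thus `A u + B v` is the wanted relation once `A` and `B` are
  -- free of `x` and `y`.
  obtain ⟨A, B, g, hAB, hA, hB⟩ :=
    UniqueFactorizationMonoid.exists_reduced_factors (pderiv 0 v) hv (pderiv 1 v)
  have hg : g ≠ 0 := by rintro rfl; simp [← hA] at hv
  have hA0 : A ≠ 0 := by rintro rfl; simp [← hA] at hv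
  have h1 : A * pderiv 1 u = -(B * (B * g)) := by
    apply mul_left_cancel₀ hg
    rw [hux, ← hA, ← hB] at det
    linear_combination -det
  obtain ⟨k, rfl⟩ : A ∣ g :=
    hAB.dvd_of_dvd_mul_left (hAB.dvd_of_dvd_mul_left ((dvd_neg).1 ⟨_, h1.symm⟩))
  have hk : k ≠ 0 := right_ne_zero_of_mul hg
  have huy : pderiv 1 u = -(B ^ 2 * k) := by
    apply mul_left_cancel₀ hA0
    linear_combination h1
  have m1 : pderiv 1 (A * k * A) = pderiv 0 (A * k * B) := by
    rw [hA, hB, pderiv_comm]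
  have m2 : pderiv 1 (-(A * k * B)) = pderiv 0 (-(B ^ 2 * k)) := by
    rw [← huy, hB, ← hux, pderiv_comm]
  simp only [map_neg, pderiv_mul, pow_two] at m1 m2
  -- This combination of the symmetries of the mixed partials of `v` and `u` eliminates the
  -- derivatives of `k`.
  have key : B * A * pderiv 1 A - A ^ 2 * pderiv 1 B =
      pderiv 0 A * B ^ 2 - A * B * pderiv 0 B := by
    apply mul_left_cancel₀ hk
    linear_combination B * m1 + A * m2
  have hAx : pderiv 0 A = 0 := by
    apply pderiv_eq_zero_of_dvd
    apply hAB.dvd_of_dvd_mul_left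
    apply hAB.dvd_of_dvd_mul_left
    exact ⟨B * pderiv 1 A - A * pderiv 1 B + B * pderiv 0 B, by linear_combination -key⟩
  have key' : A * pderiv 1 B = B * (pderiv 1 A + pderiv 0 B) := by
    apply mul_left_cancel₀ hA0
    rw [hAx] at key
    linear_combination -key
  have hBy : pderiv 1 B = 0 := by
    apply pderiv_eq_zero_of_dvd
    exact hAB.symm.dvd_of_dvd_mul_left ⟨_, key'⟩
  have hAy : pderiv 1 A = 0 := by
    by_cases hB0 : B = 0
    · apply pderiv_eq_zero_of_dvd
      rw [hB0, isRelPrime_zero_right] at hAB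
      exact hAB.dvd
    · by_contra hα
      rw [hBy, mul_zero] at key'
      have hBx : pderiv 0 B = -pderiv 1 A :=
        eq_neg_of_add_eq_zero_right ((mul_eq_zero.1 key'.symm).resolve_left hB0)
      apply hv
      -- Differentiating `B ∂v/∂x = A ∂v/∂y` in `x` shows that `∂v/∂x` is an eigenvector for `α =
      -- ∂A/∂y`.
      apply eq_zero_of_euler_eigenvector hα hAx rfl hBx hBy one_ne_zero
      have h2 : B * pderiv 0 v - A * pderiv 1 v = 0 := by
        rw [← hA, ← hB]
        ring
      have h3 := congrArg (pderiv 0) h2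
      simp only [map_sub, pderiv_mul, hAx, hBx, map_zero, pderiv_comm 0 1 v] at h3
      push_cast
      linear_combination h3
  have hBx : pderiv 0 B = 0 := by
    by_cases hB0 : B = 0
    · rw [hB0, map_zero]
    · rw [hBy, mul_zero, hAy, zero_add] at key'
      exact (mul_eq_zero.1 key'.symm).resolve_left hB0
  obtain ⟨a, ha⟩ := exists_eq_polyInZ hAx hAy
  obtain ⟨b, hb⟩ := exists_eq_polyInZ hBx hBy
  obtain ⟨c, hc⟩ := exists_eq_polyInZ (p := A * u + B * v)
    (by
      rw [map_add, pderiv_mul, pderiv_mul, hAx, hBx, hux, ← hA, ← hB]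
      ring)
    (by
      rw [map_add, pderiv_mul, pderiv_mul, hAy, hBy, huy, ← hB]
      ring)
  subst ha hb
  exact ⟨a, b, c, isCoprime_of_isRelPrime_polyInZ hAB, hc⟩

/-- By Bézout, `s = a x + b y` and `t = -q x + p y` are coordinates over `K[z]`, with inverse `x = p
s - b t`, `y = q s + a t`. The hypothesis says that `w` does not depend on `t`, so `t = 0` gives `w
= w(p s, q s, z)`. -/
theorem exists_eq_evalOverZ {a b : Polynomial K} (hab : IsCoprime a b)
    {w : MvPolynomial (Fin 3) K}
    (hw : polyInZ b * pderiv 0 w = polyInZ a * pderiv 1 w) :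
    ∃ f, w = evalOverZ f (polyInZ a * X 0 + polyInZ b * X 1) := by
  obtain ⟨p, q, hpq⟩ := hab
  have hpq' : polyInZ p * polyInZ a + polyInZ q * polyInZ b = 1 := by
    rw [← map_mul, ← map_mul, ← map_add, hpq, map_one]
  obtain ⟨s, hs⟩ : ∃ s, s = polyInZ a * X 0 + polyInZ b * X 1 := ⟨_, rfl⟩
  rw [← hs]
  set g : Fin 3 → MvPolynomial (Fin 3) K :=
    ![polyInZ p * X 0 - polyInZ b * X 1, polyInZ q * X 0 + polyInZ a * X 1, X 2] with hg
  have hgz : ∀ c : Polynomial K, aeval g (polyInZ c) = polyInZ c := fun c => aeval_polyInZ g c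
  have hW : pderiv 1 (aeval g w) = 0 := by
    have h0 : pderiv 1 (g 0) = -polyInZ b := by
      simp [hg, pderiv_polyInZ, pderiv_X]
    have h1 : pderiv 1 (g 1) = polyInZ a := by
      simp [hg, pderiv_polyInZ, pderiv_X]
    have h2 : pderiv 1 (g 2) = 0 := by
      simp [hg, pderiv_X]
    have h3 := congrArg (aeval g) hw
    rw [map_mul, map_mul, hgz, hgz] at h3
    rw [derivation_aeval, Fin.sum_univ_three, h0, h1, h2, smul_eq_mul, smul_eq_mul, smul_zero]
    linear_combination -h3
  -- The left side undoes `g` and returns `w`; the right side sets `t = 0`.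
  have hcongr : aeval ![s, -polyInZ q * X 0 + polyInZ p * X 1, X 2] (aeval g w) =
      aeval (R := K) ![s, 0, X 2] (aeval g w) := by
    refine hom_congr_vars (f₁ := (aeval _).toRingHom) (f₂ := (aeval _).toRingHom)
      (by ext1 x; simp) ?_ rfl
    intro i hi _
    fin_cases i
    · simp
    · exact absurd hi (notMem_vars_of_pderiv_eq_zero hW)
    · simp
  rw [← AlgHom.comp_apply, ← AlgHom.comp_apply, comp_aeval, comp_aeval] at hcongr
  refine ⟨aeval ![Polynomial.C p * Polynomial.X, Polynomial.C q * Polynomial.X,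
    Polynomial.C Polynomial.X] w, ?_⟩
  rw [evalOverZ_aeval]
  have e1 : (fun i => aeval ![s, -polyInZ q * X 0 + polyInZ p * X 1, X 2] (g i)) =
      (X : Fin 3 → MvPolynomial (Fin 3) K) := by
    funext i
    fin_cases i
    · change aeval _ (polyInZ p * X 0 - polyInZ b * X 1) = X 0
      rw [map_sub, map_mul, map_mul, aeval_X, aeval_X, aeval_polyInZ, aeval_polyInZ]
      change polyInZ p * s - polyInZ b * (-polyInZ q * X 0 + polyInZ p * X 1) = X 0
      linear_combination X 0 * hpq' + polyInZ p * hs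
    · change aeval _ (polyInZ q * X 0 + polyInZ a * X 1) = X 1
      rw [map_add, map_mul, map_mul, aeval_X, aeval_X, aeval_polyInZ, aeval_polyInZ]
      change polyInZ q * s + polyInZ a * (-polyInZ q * X 0 + polyInZ p * X 1) = X 1
      linear_combination X 1 * hpq' + polyInZ q * hs
    · exact aeval_X _ 2
  have e2 : (fun i => aeval ![s, 0, X 2] (g i)) = fun i => evalOverZ ((![Polynomial.C p *
      Polynomial.X, Polynomial.C q * Polynomial.X, Polynomial.C Polynomial.X] : Fin 3 → _) i) s := by
    funext i
    fin_cases i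
    · change aeval _ (polyInZ p * X 0 - polyInZ b * X 1) =
        Polynomial.eval₂ _ s (Polynomial.C p * Polynomial.X)
      rw [map_sub, map_mul, map_mul, aeval_X, aeval_X, aeval_polyInZ, Polynomial.eval₂_mul,
        Polynomial.eval₂_C, Polynomial.eval₂_X]
      change polyInZ p * s - _ * 0 = polyInZ p * s
      ring
    · change aeval _ (polyInZ q * X 0 + polyInZ a * X 1) =
        Polynomial.eval₂ _ s (Polynomial.C q * Polynomial.X)
      rw [map_add, map_mul, map_mul, aeval_X, aeval_X, aeval_polyInZ, Polynomial.eval₂_mul,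
        Polynomial.eval₂_C, Polynomial.eval₂_X]
      change polyInZ q * s + _ * 0 = polyInZ q * s
      ring
    · change aeval _ (X 2) = Polynomial.eval₂ _ s (Polynomial.C Polynomial.X)
      rw [aeval_X, Polynomial.eval₂_C]
      exact (Polynomial.aeval_X _).symm
  rw [e1, e2, aeval_X_left_apply] at hcongr
  exact hcongr

/-- With `p a + q b = 1`, the relation `a u + b v = c` is solved by `w = q u - p v`, and the trace
becomes `b ∂w/∂x = a ∂w/∂y`. -/
theorem exists_normal_form {u v : MvPolynomial (Fin 3) K}
    (trace : pderiv 0 u + pderiv 1 v = 0)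
    (det : pderiv 0 u * pderiv 1 v - pderiv 1 u * pderiv 0 v = 0) :
    ∃ (a₁ a₂ c₁ c₂ : Polynomial K) (f : Polynomial (Polynomial K)),
      u = polyInZ a₂ * evalOverZ f (polyInZ a₁ * X 0 + polyInZ a₂ * X 1) + polyInZ c₁ ∧
      v = -polyInZ a₁ * evalOverZ f (polyInZ a₁ * X 0 + polyInZ a₂ * X 1) + polyInZ c₂ := by
  obtain ⟨a, b, c, hab, hc⟩ := exists_coprime_relation trace det
  obtain ⟨p, q, hpq⟩ := id hab
  have hpq' : polyInZ p * polyInZ a + polyInZ q * polyInZ b = 1 := by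
    rw [← map_mul, ← map_mul, ← map_add, hpq, map_one]
  have hu : u = polyInZ b * (polyInZ q * u - polyInZ p * v) + polyInZ (p * c) := by
    rw [map_mul, ← hc]
    linear_combination -u * hpq'
  have hv : v = -polyInZ a * (polyInZ q * u - polyInZ p * v) + polyInZ (q * c) := by
    rw [map_mul, ← hc]
    linear_combination -v * hpq'
  generalize polyInZ q * u - polyInZ p * v = w at hu hv
  have hux := congrArg (pderiv 0) hu
  have hvy := congrArg (pderiv 1) hv
  simp only [map_add, pderiv_mul, map_neg, pderiv_polyInZ (show (0 : Fin 3) ≠ 2 by decide),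
    pderiv_polyInZ (show (1 : Fin 3) ≠ 2 by decide)] at hux hvy
  obtain ⟨f, hf⟩ := exists_eq_evalOverZ hab (w := w)
    (by linear_combination trace - hux - hvy)
  exact ⟨a, b, p * c, q * c, f, by rw [← hf]; exact hu, by rw [← hf]; exact hv⟩

end Burgers

/-! ### Assembly of the theorem. -/

theorem conj_one {n : ℕ} {K : Type*} [Field K] (F : PolyMap n K) : PolyMap.conj 1 F = F := by
  have h : PolyMap.ofMatrix (1 : Matrix (Fin n) (Fin n) K) = X := by
    funext i
    simp [PolyMap.ofMatrix, Matrix.one_apply]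
  have h1 : PolyMap.comp F X = F := funext fun i => by simp [PolyMap.comp]
  have h2 : PolyMap.comp X F = F := funext fun i => by simp [PolyMap.comp]
  rw [PolyMap.conj, inv_one, Units.val_one, h, h1, h2]

/-- Twice the sum of the principal minors is `(tr A)² - tr A²`, and both traces vanish. -/
theorem trace_minor_det_of_isNilpotent {R : Type*} [CommRing R] [IsDomain R] [CharZero R]
    {A : Matrix (Fin 3) (Fin 3) R} (hA : IsNilpotent A) :
    A.trace = 0 ∧ A 0 0 * A 1 1 - A 0 1 * A 1 0 + (A 0 0 * A 2 2 - A 0 2 * A 2 0) +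
      (A 1 1 * A 2 2 - A 1 2 * A 2 1) = 0 ∧ A.det = 0 := by
  have h1 : A.trace = 0 := (Matrix.isNilpotent_trace_of_isNilpotent hA).eq_zero
  have h2 : (A ^ 2).trace = 0 :=
    (Matrix.isNilpotent_trace_of_isNilpotent (hA.pow_of_pos two_ne_zero)).eq_zero
  have h3 : A.det = 0 := by
    obtain ⟨m, hm⟩ := hA
    refine IsReduced.eq_zero _ ⟨m, ?_⟩
    rw [← Matrix.det_pow, hm, Matrix.det_zero]
  refine ⟨h1, ?_, h3⟩
  rw [pow_two, Matrix.trace_fin_three] at h2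
  rw [Matrix.trace_fin_three] at h1
  simp only [Matrix.mul_apply, Fin.sum_univ_three] at h2
  apply mul_left_cancel₀ (two_ne_zero (α := R))
  linear_combination (A 0 0 + A 1 1 + A 2 2) * h1 - h2

theorem eq_C_eval_zero {K : Type*} [Field K] [CharZero K] {h : MvPolynomial (Fin 2) K}
    (h0 : pderiv 0 h = 0) (h1 : pderiv 1 h = 0) : h = C (eval 0 h) := by
  refine hom_congr_vars (f₁ := RingHom.id (MvPolynomial (Fin 2) K)) (f₂ := C.comp (eval 0))
    (by ext1 x; simp) ?_ rfl
  intro i hi _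
  fin_cases i
  · exact absurd hi (notMem_vars_of_pderiv_eq_zero h0)
  · exact absurd hi (notMem_vars_of_pderiv_eq_zero h1)

theorem mainTheorem5 {K : Type*} [Field K] [CharZero K]
    (u v : MvPolynomial (Fin 3) K) (h : MvPolynomial (Fin 2) K)
    (H : PolyMap 3 K) (hH : H = ![u, v, MvPolynomial.rename Fin.castSucc h])
    (hv : MvPolynomial.degreeOf 2 v = 1)
    (hH0 : ∀ i, MvPolynomial.eval 0 (H i) = 0)
    (hu : 2 ≤ MvPolynomial.degreeOf 2 u)
    (hnil : IsNilpotent (PolyMap.jacobian H)) :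
    ∃ (T : GL (Fin 3) K) (a₁ a₂ c₁ c₂ : Polynomial K) (f : Polynomial (Polynomial K)),
      PolyMap.conj T H =
        ![polyInZ a₂ * evalOverZ f
              (polyInZ a₁ * MvPolynomial.X 0 + polyInZ a₂ * MvPolynomial.X 1) + polyInZ c₁,
          -polyInZ a₁ * evalOverZ f
              (polyInZ a₁ * MvPolynomial.X 0 + polyInZ a₂ * MvPolynomial.X 1) + polyInZ c₂,
          0] := by
  obtain ⟨trace, minor, det⟩ := trace_minor_det_of_isNilpotent hnil
  have hinj : Function.Injective (Fin.castSucc : Fin 2 → Fin 3) := Fin.castSucc_injective 2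
  have hx : pderiv 0 (rename Fin.castSucc h) = rename Fin.castSucc (pderiv 0 h) :=
    pderiv_rename hinj 0 h
  have hy : pderiv 1 (rename Fin.castSucc h) = rename Fin.castSucc (pderiv 1 h) :=
    pderiv_rename hinj 1 h
  have hz : pderiv 2 (rename Fin.castSucc h) = 0 := by
    apply polynomialInZ.injective
    rw [polynomialInZ_pderiv_two, polynomialInZ_rename_castSucc, Polynomial.derivative_C, map_zero]
  rw [Matrix.trace_fin_three] at trace
  rw [Matrix.det_fin_three] at det
  simp only [PolyMap.jacobian, Matrix.of_apply, hH, Matrix.cons_val_zero, Matrix.cons_val_one,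
    Matrix.cons_val, hx, hy, hz] at trace minor det
  have hh := pderiv_eq_zero_of_nilpotent_jacobian hv hu (h := h)
    (by linear_combination trace) (by linear_combination minor) (by linear_combination det)
  have hh0 : rename Fin.castSucc h = (0 : MvPolynomial (Fin 3) K) := by
    rw [eq_C_eval_zero hh.1 hh.2, rename_C]
    have h2 := hH0 2
    rw [hH] at h2
    change eval 0 (rename Fin.castSucc h) = 0 at h2
    rw [eval_rename] at h2
    exact (congrArg C h2).trans C_0
  rw [hh.1, hh.2, map_zero] at minor
  obtain ⟨a₁, a₂, c₁, c₂, f, h1, h2⟩ := exists_normal_form (u := u) (v := v)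
    (by linear_combination trace) (by linear_combination minor)
  refine ⟨1, a₁, a₂, c₁, c₂, f, ?_⟩
  rw [conj_one, hH, ← h1, ← h2, hh0]
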